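/- Let $k$ be an algebraically closed field of characteristic $p \ge 0$, let $d \ge 1$ be an integer, and assume that $p = 0$ or $p > d$. Let $P_1, \dots, P_n$ ($n \ge 0$) be distinct points of $\mathbb{P}^1_k$ and let $e_1, \dots, e_n \ge 2$ be integers with $$\sum_{i=1}^n (e_i - 1) = 2d - 2 .$$ Then, modulo automorphisms of the image (that is, identifying $\varphi$ with $g \circ \varphi$ for $g \in \operatorname{Aut}(\mathbb{P}^1_k) = \operatorname{PGL}_2(k)$), there are only finitely many morphisms $\varphi : \mathbb{P}^1_k \to \mathbb{P}^1_k$ of degree $d$ whose ramification index at $P_i$ equals $e_i$ for every $i$. In other words, there are, up to automorphism of the image, only finitely many self-maps of $\mathbb{P}^1_k$ of degree $d$ with the specified (tame) ramification divisor $\sum_i (e_i - 1) P_i$. -/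

import Mathlib

open scoped LinearAlgebra.Projectivization

namespace SelfMapsP1

variable {k : Type*} [Field k]

/-- The (closed points of the) projective line over `k`. -/
abbrev P1 (k : Type*) [Field k] : Type _ := ℙ k (Fin 2 → k)

/-- A self-map (morphism) of degree `d` of the projective line over an algebraically closed field,
presented as `[x : y] ↦ [F₀(x, y) : F₁(x, y)]` with `F₀, F₁` binary forms of degree `d` without
common zero. Two presentations give the same morphism iff they induce the same `SelfMap.toFun`
(equivalently, iff they differ by a nonzero scalar). -/
structure SelfMap (k : Type*) [Field k] (d : ℕ) where
  form : Fin 2 → MvPolynomial (Fin 2) k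
  isHomogeneous : ∀ i, (form i).IsHomogeneous d
  no_common_zero : ∀ v : Fin 2 → k, v ≠ 0 → (fun i => MvPolynomial.eval v (form i)) ≠ 0

/-- The linear form `v₁ X₀ - v₀ X₁`, whose only zero on the projective line is `[v₀ : v₁]`. -/
noncomputable def linForm (v : Fin 2 → k) : MvPolynomial (Fin 2) k :=
  MvPolynomial.C (v 1) * MvPolynomial.X 0 - MvPolynomial.C (v 0) * MvPolynomial.X 1

/-- The order of vanishing at the point `P` of a form on the projective line. -/
noncomputable def ordAt (P : P1 k) (H : MvPolynomial (Fin 2) k) : ℕ∞ :=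
  emultiplicity (linForm P.rep) H

namespace SelfMap

variable {d : ℕ}

/-- The map on points induced by a self-map. -/
noncomputable def toFun (φ : SelfMap k d) (P : P1 k) : P1 k :=
  Projectivization.mk k (fun i => MvPolynomial.eval P.rep (φ.form i))
    (φ.no_common_zero P.rep P.rep_nonzero)

/-- The induced map does not depend on the homogeneous coordinates chosen. -/
theorem toFun_mk (φ : SelfMap k d) (v : Fin 2 → k) (hv : v ≠ 0) :
    φ.toFun (Projectivization.mk k v hv) =
      Projectivization.mk k (fun i => MvPolynomial.eval v (φ.form i)) (φ.no_common_zero v hv) := by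
  obtain ⟨a, ha⟩ := Projectivization.exists_smul_eq_mk_rep k v hv
  unfold toFun
  rw [Projectivization.mk_eq_mk_iff']
  refine ⟨(a : k) ^ d, ?_⟩
  funext i
  rw [← ha]
  have key : MvPolynomial.eval (a • v) (φ.form i) = (a : k) ^ d * MvPolynomial.eval v (φ.form i) := by
    rw [MvPolynomial.eval_eq, MvPolynomial.eval_eq, Finset.mul_sum]
    refine Finset.sum_congr rfl fun m hm => ?_
    have hdeg : ∑ j ∈ m.support, m j = d := by
      have := φ.isHomogeneous i (MvPolynomial.mem_support_iff.mp hm)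
      simpa [Finsupp.weight_apply, Finsupp.sum] using this
    have : ∀ j, (a • v) j = (a : k) * v j := fun j => rfl
    simp only [this, mul_pow, Finset.prod_mul_distrib, Finset.prod_pow_eq_pow_sum, hdeg]
    ring
  simp [key]

/-- The form `Q₁ F₀ - Q₀ F₁` of degree `d`, i.e. the pullback of the linear form vanishing at `Q`;
it cuts out the scheme-theoretic fibre over `Q`. -/
noncomputable def fiberForm (φ : SelfMap k d) (Q : P1 k) : MvPolynomial (Fin 2) k :=
  MvPolynomial.C (Q.rep 1) * φ.form 0 - MvPolynomial.C (Q.rep 0) * φ.form 1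

/-- The ramification index of `φ` at `P`: the order of vanishing at `P` of the pullback of a local
parameter at `φ(P)`, i.e. the multiplicity of `P` in the fibre of `φ` over `φ(P)`. -/
noncomputable def ramificationIndex (φ : SelfMap k d) (P : P1 k) : ℕ∞ :=
  ordAt P (φ.fiberForm (φ.toFun P))

/-- Self-maps modulo automorphisms of the image: `φ ∼ ψ` iff `ψ = g ∘ φ` for a
projective-linear automorphism `g` of the projective line. -/
def imageAutSetoid (k : Type*) [Field k] (d : ℕ) : Setoid (SelfMap k d) where
  r φ ψ := ∃ g : LinearMap.GeneralLinearGroup k (Fin 2 → k), ∀ P, ψ.toFun P = g • φ.toFun P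
  iseqv :=
    { refl := fun _ => ⟨1, fun _ => (one_smul _ _).symm⟩
      symm := fun ⟨g, hg⟩ => ⟨g⁻¹, fun P => by rw [hg P, inv_smul_smul]⟩
      trans := fun ⟨g, hg⟩ ⟨h, hh⟩ => ⟨h * g, fun P => by rw [hh P, hg P, mul_smul]⟩ }

end SelfMap

end SelfMapsP1

/-!
The idea is to recover a self-map from its ramification divisor through the Wronskian. Two
self-maps differ by an automorphism of the image exactly when their defining forms span the same
pencil, a point of the Grassmannian of planes in the space of forms of degree `d`.

Ramification of index `e` at `P` makes the Jacobian determinant of the pencil vanish to order at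
least `e - 1` at `P`. The Jacobian is a form of degree `2d - 2 = ∑ (e i - 1)`, and it is nonzero
because `1, …, d` are invertible in `k` (`wronskian_ne_zero`), so up to a scalar it is the product
of the `linForm (P i) ^ (e i - 1)`. On the affine line `[t : 1]` the Jacobian is, by Euler's
identity, `-d` times the Wronskian (`dehomogenize_jacobian`). It remains to see that only finitely
many pencils have a given Wronskian (`finite_plucker`).

The Wronskian is linear in the Plücker coordinates and vanishes on no plane, so it defines a finite
morphism from the Grassmannian to projective space. Concretely, the Plücker coordinates of the
generic pair of polynomials of degree at most `d` are integral over the ring generated by the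
coefficients of its Wronskian (`isIntegral_plucker`), as is checked with the valuative criterion
for integrality: over a valuation ring, any pencil has a basis whose reduction is independent, and
the Wronskian of that basis does not reduce to zero (`plucker_mem_valuationSubring`).
Specializing the integral equations leaves finitely many values for each Plücker coordinate once
the Wronskian is fixed, and the Plücker coordinates determine the pencil
(`exists_det_ne_zero_of_plucker_eq`).
-/

namespace SelfMapsP1

open Polynomial

/-! ### Wronskians and Plücker coordinates of pairs of polynomials -/

/-- The Plücker coordinate with index `(i, j)` of a pair of polynomials: a `2 × 2` minor of the
matrix of their coefficients. -/
def plucker {R : Type*} [CommRing R] (f g : R[X]) (i j : ℕ) : R :=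
  f.coeff i * g.coeff j - f.coeff j * g.coeff i

lemma coeff_X_mul_derivative {R : Type*} [CommRing R] (f : R[X]) (n : ℕ) :
    (X * derivative f).coeff n = n * f.coeff n := by
  cases n with
  | zero => simp
  | succ n => rw [coeff_X_mul, coeff_derivative]; push_cast; ring

lemma natDegree_X_mul_derivative_le {R : Type*} [CommRing R] (f : R[X]) :
    (X * derivative f).natDegree ≤ f.natDegree := by
  rw [natDegree_le_iff_coeff_eq_zero]
  intro N hN
  rw [coeff_X_mul_derivative, coeff_eq_zero_of_natDegree_lt hN, mul_zero]

lemma wronskian_map {R S : Type*} [CommRing R] [CommRing S] (φ : R →+* S) (f g : R[X]) :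
    wronskian (f.map φ) (g.map φ) = (wronskian f g).map φ := by
  simp [wronskian, derivative_map]

lemma plucker_map {R S : Type*} [CommRing R] [CommRing S] (φ : R →+* S) (f g : R[X]) (i j : ℕ) :
    plucker (f.map φ) (g.map φ) i j = φ (plucker f g i j) := by
  simp [plucker]

section Field

variable {K : Type*} [Field K] {d : ℕ}

/-- If `f` and `g` have degrees `m < n`, the coefficient of the Wronskian in degree `m + n - 1` is
`n - m` times the product of the leading coefficients. -/
lemma wronskian_ne_zero_of_natDegree_lt (hd : ∀ n : ℕ, 1 ≤ n → n ≤ d → (n : K) ≠ 0) {f g : K[X]}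
    (hf : f ≠ 0) (hfg : f.natDegree < g.natDegree) (hg : g.natDegree ≤ d) :
    wronskian f g ≠ 0 := by
  intro h
  have h1 : f * (X * derivative g) = (X * derivative f) * g := by
    rw [wronskian, sub_eq_zero] at h
    linear_combination X * h
  have h2 := congrArg (fun q => q.coeff (f.natDegree + g.natDegree)) h1
  simp only [coeff_mul_add_eq_of_natDegree_le le_rfl (natDegree_X_mul_derivative_le g),
    coeff_mul_add_eq_of_natDegree_le (natDegree_X_mul_derivative_le f) le_rfl,
    coeff_X_mul_derivative] at h2
  have hg0 : g ≠ 0 := by rintro rfl; simp at hfg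
  have hdiff := hd (g.natDegree - f.natDegree) (by omega) (by omega)
  rw [Nat.cast_sub hfg.le] at hdiff
  refine mul_ne_zero (mul_ne_zero hdiff (leadingCoeff_ne_zero.mpr hf))
    (leadingCoeff_ne_zero.mpr hg0) ?_
  simp only [leadingCoeff]
  linear_combination h2

/-- If `1, …, d` are invertible, linearly independent polynomials of degree at most `d` have a
nonzero Wronskian. -/
theorem wronskian_ne_zero (hd : ∀ n : ℕ, 1 ≤ n → n ≤ d → (n : K) ≠ 0) {f g : K[X]}
    (hf : f.natDegree ≤ d) (hg : g.natDegree ≤ d)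
    (hind : ∀ a b : K, C a * f + C b * g = 0 → a = 0 ∧ b = 0) : wronskian f g ≠ 0 := by
  have hf0 : f ≠ 0 := by
    rintro rfl
    simpa using (hind 1 0 (by simp)).1
  have hg0 : g ≠ 0 := by
    rintro rfl
    simpa using (hind 0 1 (by simp)).2
  rcases lt_trichotomy f.natDegree g.natDegree with h | h | h
  · exact wronskian_ne_zero_of_natDegree_lt hd hf0 h hg
  · -- Cancelling the leading term of `g` against `f` does not change the Wronskian.
    set c := g.leadingCoeff / f.leadingCoeff with hc
    have hlf : f.leadingCoeff ≠ 0 := leadingCoeff_ne_zero.mpr hf0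
    set r := g - C c * f with hr
    have hr0 : r ≠ 0 := by
      intro h0
      have := (hind (-c) 1 (by
        rw [hr] at h0; simp only [map_neg, map_one]; linear_combination h0)).2
      exact one_ne_zero this
    have hw : wronskian f g = -wronskian r f := by
      simp only [hr, wronskian, derivative_sub, derivative_mul, derivative_C]
      ring
    rw [hw, neg_ne_zero]
    have hle : r.natDegree ≤ f.natDegree := by
      refine (natDegree_sub_le _ _).trans (max_le h.ge (natDegree_C_mul_le _ _))
    have hcoeff : r.coeff f.natDegree = 0 := by
      have : c * f.leadingCoeff = g.leadingCoeff := by rw [hc]; field_simp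
      simp only [leadingCoeff] at this
      rw [hr, coeff_sub, coeff_C_mul, this, h, sub_self]
    refine wronskian_ne_zero_of_natDegree_lt hd hr0 (lt_of_le_of_ne hle fun he => ?_) hf
    rw [← he] at hcoeff
    exact hr0 (leadingCoeff_eq_zero.mp hcoeff)
  · rw [← wronskian_neg_eq, neg_ne_zero]
    exact wronskian_ne_zero_of_natDegree_lt hd hg0 h hf

/-- If the coefficients of a pair of polynomials over a valuation ring at `J` and `I` form the
identity matrix, its Wronskian has a unit coefficient, because the pair stays independent over the
residue field. -/
lemma exists_isUnit_coeff_wronskian (V : ValuationSubring K)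
    (hd : ∀ n : ℕ, 1 ≤ n → n ≤ d → (n : K) ≠ 0 ∧ (n : K)⁻¹ ∈ V) {f g : V[X]}
    (hf : f.natDegree ≤ d) (hg : g.natDegree ≤ d) {I J : ℕ} (hfI : f.coeff I = 0)
    (hfJ : f.coeff J = 1) (hgI : g.coeff I = 1) (hgJ : g.coeff J = 0) :
    ∃ m, IsUnit ((wronskian f g).coeff m) := by
  -- In the residue field the `2 × 2` identity block makes `f` and `g` independent.
  have hne : wronskian (f.map (IsLocalRing.residue V)) (g.map (IsLocalRing.residue V)) ≠ 0 := by
    refine wronskian_ne_zero (d := d) (fun n h1 h2 => ?_) (natDegree_map_le.trans hf)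
      (natDegree_map_le.trans hg) fun a b hab => ?_
    · obtain ⟨h0, hV⟩ := hd n h1 h2
      have hu : IsUnit (n : V) := by
        refine IsUnit.of_mul_eq_one ⟨(n : K)⁻¹, hV⟩ (Subtype.ext ?_)
        simp [h0]
      simpa using (hu.map (IsLocalRing.residue V)).ne_zero
    · have hI := congrArg (fun q => q.coeff I) hab
      have hJ := congrArg (fun q => q.coeff J) hab
      simp [hfI, hgI, hfJ, hgJ] at hI hJ
      exact ⟨hJ, hI⟩
  rw [wronskian_map] at hne
  obtain ⟨m, hm⟩ : ∃ m, ((wronskian f g).map (IsLocalRing.residue V)).coeff m ≠ 0 := by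
    by_contra! h
    exact hne (Polynomial.ext (by simpa using h))
  exact ⟨m, by rwa [coeff_map, IsLocalRing.residue_ne_zero_iff_isUnit] at hm⟩

/-- The combination of `f` and `g` whose coefficients are the Plücker coordinates with first
index `I`. -/
noncomputable def pluckerRow {R : Type*} [CommRing R] (f g : R[X]) (I : ℕ) : R[X] :=
  C (f.coeff I) * g - C (g.coeff I) * f

lemma coeff_pluckerRow {R : Type*} [CommRing R] (f g : R[X]) (I m : ℕ) :
    (pluckerRow f g I).coeff m = plucker f g I m := by
  simp only [pluckerRow, plucker, coeff_sub, coeff_C_mul]; ring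

lemma wronskian_pluckerRow {R : Type*} [CommRing R] (f g : R[X]) (I J : ℕ) :
    wronskian (pluckerRow f g I) (pluckerRow f g J) = C (plucker f g I J) * wronskian f g := by
  simp only [pluckerRow, plucker, wronskian, derivative_mul, derivative_C, map_sub, map_mul]
  ring

lemma natDegree_pluckerRow_le {R : Type*} [CommRing R] {f g : R[X]} (hf : f.natDegree ≤ d)
    (hg : g.natDegree ≤ d) (I : ℕ) : (pluckerRow f g I).natDegree ≤ d :=
  (natDegree_sub_le _ _).trans
    (max_le ((natDegree_C_mul_le _ _).trans hg) ((natDegree_C_mul_le _ _).trans hf))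

lemma plucker_eq_zero_of_lt {R : Type*} [CommRing R] {f g : R[X]} (hf : f.natDegree ≤ d)
    (hg : g.natDegree ≤ d) {i j : ℕ} (h : d < i ∨ d < j) : plucker f g i j = 0 := by
  unfold plucker
  rcases h with h | h
  · rw [coeff_eq_zero_of_natDegree_lt (hf.trans_lt h),
      coeff_eq_zero_of_natDegree_lt (hg.trans_lt h)]
    simp
  · rw [coeff_eq_zero_of_natDegree_lt (hf.trans_lt h),
      coeff_eq_zero_of_natDegree_lt (hg.trans_lt h)]
    simp

/-! ### Integrality of the Plücker coordinates over the Wronskian -/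

/-- A valuation ring containing the coefficients of the Wronskian of a pair contains its Plücker
coordinates: after dividing by a Plücker coordinate of largest valuation, the span of the pair
acquires a basis over the valuation ring whose Wronskian has a unit coefficient. -/
theorem plucker_mem_valuationSubring (V : ValuationSubring K)
    (hd : ∀ n : ℕ, 1 ≤ n → n ≤ d → (n : K) ≠ 0 ∧ (n : K)⁻¹ ∈ V) {f g : K[X]}
    (hf : f.natDegree ≤ d) (hg : g.natDegree ≤ d) (hw : ∀ m, (wronskian f g).coeff m ∈ V)
    (i j : ℕ) : plucker f g i j ∈ V := by
  obtain ⟨⟨I, J⟩, -, hmax⟩ := Finset.exists_max_image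
    (Finset.range (d + 1) ×ˢ Finset.range (d + 1))
    (fun q => V.valuation (plucker f g q.1 q.2)) ⟨(0, 0), by simp⟩
  have hmax' : ∀ i j, V.valuation (plucker f g i j) ≤ V.valuation (plucker f g I J) := by
    intro i j
    by_cases hij : d < i ∨ d < j
    · rw [plucker_eq_zero_of_lt hf hg hij, map_zero]
      exact zero_le
    · push Not at hij
      exact hmax (i, j) (by simp; omega)
  set q := plucker f g I J with hq
  rw [← ValuationSubring.valuation_le_one_iff]
  refine (hmax' i j).trans ?_
  rw [ValuationSubring.valuation_le_one_iff]
  by_cases hq0 : q = 0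
  · rw [hq0]; exact V.zero_mem
  have hquot : ∀ i j, q⁻¹ * plucker f g i j ∈ V := by
    intro i j
    rw [← ValuationSubring.valuation_le_one_iff, map_mul, map_inv₀]
    have hv : V.valuation q ≠ 0 := by simpa using hq0
    calc (V.valuation q)⁻¹ * V.valuation (plucker f g i j)
        ≤ (V.valuation q)⁻¹ * V.valuation q := by gcongr; exact hmax' i j
      _ = 1 := inv_mul_cancel₀ hv
  have hlift : ∀ L, ∃ F : V[X], F.map V.subtype = C q⁻¹ * pluckerRow f g L ∧
      F.natDegree ≤ d := by
    intro L
    have hmem : C q⁻¹ * pluckerRow f g L ∈ Polynomial.lifts V.subtype := by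
      rw [Polynomial.lifts_iff_coeff_lifts]
      intro m
      rw [coeff_C_mul, coeff_pluckerRow]
      exact ⟨⟨_, hquot L m⟩, rfl⟩
    obtain ⟨F, hF⟩ := (Polynomial.mem_lifts _).mp hmem
    refine ⟨F, hF, ?_⟩
    rw [← natDegree_map_eq_of_injective V.subtype_injective F, hF]
    exact (natDegree_C_mul_le _ _).trans (natDegree_pluckerRow_le hf hg L)
  obtain ⟨F, hF, hFd⟩ := hlift I
  obtain ⟨G, hG, hGd⟩ := hlift J
  have hFc : ∀ m, V.subtype (F.coeff m) = q⁻¹ * plucker f g I m := fun m => by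
    rw [← coeff_map, hF, coeff_C_mul, coeff_pluckerRow]
  have hGc : ∀ m, V.subtype (G.coeff m) = q⁻¹ * plucker f g J m := fun m => by
    rw [← coeff_map, hG, coeff_C_mul, coeff_pluckerRow]
  -- The sign on `G` compensates for `plucker f g J I = -plucker f g I J`.
  have hJI : plucker f g J I = -q := by rw [hq]; unfold plucker; ring
  obtain ⟨m, hm⟩ := exists_isUnit_coeff_wronskian V hd (f := F) (g := -G) (I := I) (J := J) hFd
    (by rwa [natDegree_neg])
    (V.subtype_injective (by rw [hFc]; simp [plucker, mul_comm]))
    (V.subtype_injective (by rw [hFc, ← hq, inv_mul_cancel₀ hq0, map_one]))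
    (V.subtype_injective (by
      rw [coeff_neg, map_neg, hGc, hJI, mul_neg, neg_neg, inv_mul_cancel₀ hq0, map_one]))
    (V.subtype_injective (by rw [coeff_neg, map_neg, hGc]; simp [plucker, mul_comm]))
  have hwm : V.subtype ((wronskian F (-G)).coeff m) = -(q⁻¹ * (wronskian f g).coeff m) := by
    rw [← coeff_map, ← wronskian_map, Polynomial.map_neg, hF, hG, wronskian_neg_right]
    have : wronskian (C q⁻¹ * pluckerRow f g I) (C q⁻¹ * pluckerRow f g J) =
        C (q⁻¹ * q⁻¹) * wronskian (pluckerRow f g I) (pluckerRow f g J) := by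
      simp only [wronskian, derivative_mul, derivative_C, map_mul]; ring
    rw [this, wronskian_pluckerRow, ← hq, ← mul_assoc, ← C_mul, coeff_neg, coeff_C_mul]
    field_simp
  obtain ⟨u, hu⟩ := hm
  have hu1 : V.subtype ↑u⁻¹ * V.subtype ↑u = 1 := by rw [← map_mul]; simp
  rw [hu, hwm] at hu1
  have hfin : q = -(V.subtype ↑u⁻¹ * (wronskian f g).coeff m) := by
    field_simp at hu1
    linear_combination -hu1
  rw [hfin]
  exact V.neg_mem _ (V.mul_mem _ _ (Subtype.coe_prop _) (hw m))

/-- The Plücker coordinates of a pair of polynomials of degree at most `d` are integral over any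
ring which contains the coefficients of the Wronskian and in which `1, …, d` are invertible. -/
theorem isIntegral_plucker {S : Type*} [CommRing S] [Algebra S K]
    (hd : ∀ n : ℕ, 1 ≤ n → n ≤ d → IsUnit (n : S)) {f g : K[X]}
    (hf : f.natDegree ≤ d) (hg : g.natDegree ≤ d)
    (hw : ∀ m, (wronskian f g).coeff m ∈ (algebraMap S K).range) (i j : ℕ) :
    IsIntegral S (plucker f g i j) := by
  have hmem : plucker f g i j ∈
      (integralClosure (Subring.closure ((algebraMap S K).range : Set K)) K).toSubring := by
    rw [← iInf_valuationSubring_superset, Subring.mem_iInf]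
    rintro ⟨V, hV⟩
    refine plucker_mem_valuationSubring V (fun n h1 h2 => ?_) hf hg (fun m => hV (hw m)) i j
    obtain ⟨s, hs⟩ := (hd n h1 h2).exists_right_inv
    have hs' := congrArg (algebraMap S K) hs
    rw [map_mul, map_natCast, map_one] at hs'
    refine ⟨left_ne_zero_of_mul_eq_one hs', ?_⟩
    rw [inv_eq_of_mul_eq_one_right hs']
    exact hV ⟨s, rfl⟩
  rw [Subring.closure_eq] at hmem
  obtain ⟨P, hP, hP0⟩ := hmem
  obtain ⟨Q, hQ, -, hQm⟩ := Polynomial.lifts_and_natDegree_eq_and_monic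
    (f := (algebraMap S K).rangeRestrict)
    (Polynomial.map_surjective _ (algebraMap S K).rangeRestrict_surjective P) hP
  refine ⟨Q, hQm, ?_⟩
  rw [← hQ, eval₂_map] at hP0
  exact hP0

end Field

/-! ### Pencils with a given Wronskian -/

/-- The polynomial of degree at most `d` whose coefficients are the indeterminates `(s, 0), …,
(s, d)`; the indices `s = 0, 1` give the generic pair. -/
noncomputable def genericPoly (k : Type*) [Field k] (d : ℕ) (s : Fin 2) :
    (MvPolynomial (Fin 2 × ℕ) k)[X] :=
  ∑ i ∈ Finset.range (d + 1), C (MvPolynomial.X (s, i)) * X ^ i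

lemma natDegree_genericPoly_le (k : Type*) [Field k] (d : ℕ) (s : Fin 2) :
    (genericPoly k d s).natDegree ≤ d :=
  natDegree_sum_le_of_forall_le _ _ fun i hi =>
    (natDegree_C_mul_X_pow_le _ _).trans (by simpa [Nat.lt_succ_iff] using hi)

/-- Specialization of the indeterminates to the coefficients of the polynomials `u 0` and `u 1`. -/
noncomputable def specializeCoeff {k : Type*} [Field k] (u : Fin 2 → k[X]) :
    MvPolynomial (Fin 2 × ℕ) k →ₐ[k] k :=
  MvPolynomial.aeval fun q => (u q.1).coeff q.2

lemma genericPoly_map_specializeCoeff {k : Type*} [Field k] {d : ℕ} {u : Fin 2 → k[X]} {s : Fin 2}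
    (hu : (u s).natDegree ≤ d) :
    (genericPoly k d s).map (specializeCoeff u : MvPolynomial (Fin 2 × ℕ) k →+* k) = u s := by
  rw [genericPoly, Polynomial.map_sum]
  conv_rhs => rw [as_sum_range_C_mul_X_pow' (u s) (Nat.lt_succ_of_le hu)]
  simp [specializeCoeff]

/-- A Plücker coordinate takes finitely many values on the pairs of polynomials of degree at most
`d` with a given Wronskian: the integral equation it satisfies for the generic pair
specializes to an equation depending only on the Wronskian. -/
theorem finite_plucker_coord {k : Type*} [Field k] {d : ℕ}
    (hd : ∀ n : ℕ, 1 ≤ n → n ≤ d → (n : k) ≠ 0) (h : k[X]) (i j : ℕ) :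
    {x : k | ∃ u : Fin 2 → k[X], (∀ s, (u s).natDegree ≤ d) ∧ wronskian (u 0) (u 1) = h ∧
      x = plucker (u 0) (u 1) i j}.Finite := by
  let F := genericPoly k d 0
  let G := genericPoly k d 1
  let K := FractionRing (MvPolynomial (Fin 2 × ℕ) k)
  let ι : MvPolynomial (Fin 2 × ℕ) k →+* K := algebraMap _ K
  let w : MvPolynomial ℕ k →ₐ[k] MvPolynomial (Fin 2 × ℕ) k :=
    MvPolynomial.aeval fun m => (wronskian F G).coeff m
  let : Algebra (MvPolynomial ℕ k) K := (ι.comp (w : MvPolynomial ℕ k →+* _)).toAlgebra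
  have hint : IsIntegral (MvPolynomial ℕ k) (plucker (F.map ι) (G.map ι) i j) := by
    refine isIntegral_plucker (d := d) (fun n h1 h2 => ?_)
      (natDegree_map_le.trans (natDegree_genericPoly_le k d 0))
      (natDegree_map_le.trans (natDegree_genericPoly_le k d 1)) (fun m => ?_) i j
    · have := ((hd n h1 h2).isUnit).map (MvPolynomial.C : k →+* MvPolynomial ℕ k)
      rwa [map_natCast] at this
    · refine ⟨MvPolynomial.X m, ?_⟩
      rw [wronskian_map, coeff_map]
      change ι (w (MvPolynomial.X m)) = _
      simp [w, F, G]
  rw [plucker_map] at hint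
  obtain ⟨P, hP, hP0⟩ := hint
  have hroot : P.eval₂ (w : MvPolynomial ℕ k →+* _) (plucker F G i j) = 0 := by
    have hinj : Function.Injective ι := IsFractionRing.injective _ _
    apply hinj
    rw [hom_eval₂, map_zero]
    exact hP0
  let c : MvPolynomial ℕ k →+* k :=
    (MvPolynomial.aeval fun m => h.coeff m : MvPolynomial ℕ k →ₐ[k] k)
  refine ((P.map c).rootSet_finite k).subset ?_
  rintro x ⟨u, hu, hw, rfl⟩
  rw [mem_rootSet]
  refine ⟨(hP.map c).ne_zero, ?_⟩
  have hcomp : (specializeCoeff u : _ →+* k).comp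
      (w : MvPolynomial ℕ k →+* MvPolynomial (Fin 2 × ℕ) k) = c := by
    have : (specializeCoeff u).comp w = MvPolynomial.aeval fun m => h.coeff m := by
      refine MvPolynomial.algHom_ext fun m => ?_
      have : specializeCoeff u ((wronskian F G).coeff m) = h.coeff m := by
        have hm := coeff_map (p := wronskian F G) (specializeCoeff u : _ →+* k) m
        rw [← wronskian_map, genericPoly_map_specializeCoeff (hu 0),
          genericPoly_map_specializeCoeff (hu 1), hw] at hm
        exact hm.symm
      simpa [w] using this
    exact congrArg (fun a : MvPolynomial ℕ k →ₐ[k] k => (a : MvPolynomial ℕ k →+* k)) this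
  have hpl : plucker (u 0) (u 1) i j = specializeCoeff u (plucker F G i j) := by
    have := plucker_map (specializeCoeff u : _ →+* k) F G i j
    rwa [genericPoly_map_specializeCoeff (hu 0), genericPoly_map_specializeCoeff (hu 1)] at this
  have := congrArg (specializeCoeff u : _ →+* k) hroot
  rw [hom_eval₂, map_zero, hcomp] at this
  rw [hpl, coe_aeval_eq_eval, eval_map]
  exact this

/-- The Wronskian, as a map on the cone over the Grassmannian of pencils of polynomials of degree
at most `d`, has finite fibres. -/
theorem finite_plucker {k : Type*} [Field k] {d : ℕ}
    (hd : ∀ n : ℕ, 1 ≤ n → n ≤ d → (n : k) ≠ 0) (h : k[X]) :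
    {v : ℕ → ℕ → k | ∃ u : Fin 2 → k[X], (∀ s, (u s).natDegree ≤ d) ∧
      wronskian (u 0) (u 1) = h ∧ v = plucker (u 0) (u 1)}.Finite := by
  let res : (ℕ → ℕ → k) → Fin (d + 1) × Fin (d + 1) → k := fun v q => v q.1 q.2
  refine Set.Finite.of_finite_image (f := res) ?_ ?_
  · refine (Set.Finite.pi' fun q : Fin (d + 1) × Fin (d + 1) =>
      finite_plucker_coord hd h q.1 q.2).subset ?_
    rintro - ⟨v, ⟨u, hu, hw, rfl⟩, rfl⟩ q
    exact ⟨u, hu, hw, rfl⟩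
  · rintro - ⟨u, hu, -, rfl⟩ - ⟨u', hu', -, rfl⟩ heq
    funext i j
    by_cases hij : d < i ∨ d < j
    · rw [plucker_eq_zero_of_lt (hu 0) (hu 1) hij, plucker_eq_zero_of_lt (hu' 0) (hu' 1) hij]
    · push Not at hij
      exact congrFun heq (⟨i, by omega⟩, ⟨j, by omega⟩)

variable {k : Type*} [Field k] {d : ℕ}

/-! ### Binary forms and their Jacobian -/

/-- The restriction of a binary form to the affine line `[t : 1]`. -/
noncomputable def dehomogenize : MvPolynomial (Fin 2) k →ₐ[k] k[X] :=
  MvPolynomial.aeval ![X, 1]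

@[simp] lemma dehomogenize_C (a : k) : dehomogenize (MvPolynomial.C a) = C a := by
  simp [dehomogenize]

@[simp] lemma dehomogenize_X_zero :
    dehomogenize (MvPolynomial.X 0 : MvPolynomial (Fin 2) k) = X := by
  simp [dehomogenize]

@[simp] lemma dehomogenize_X_one :
    dehomogenize (MvPolynomial.X 1 : MvPolynomial (Fin 2) k) = 1 := by
  simp [dehomogenize]

lemma natDegree_dehomogenize_le {F : MvPolynomial (Fin 2) k} (hF : F.IsHomogeneous d) :
    (dehomogenize F).natDegree ≤ d := by
  have := MvPolynomial.aeval_natDegree_le (m := d) (n := 1) F hF.totalDegree_le ![X, 1]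
    (by intro i; fin_cases i <;> simp)
  rwa [mul_one] at this

lemma eval_dehomogenize (F : MvPolynomial (Fin 2) k) (t : k) :
    (dehomogenize F).eval t = MvPolynomial.eval ![t, 1] F := by
  induction F using MvPolynomial.induction_on with
  | C a => simp
  | add p q hp hq => simp [hp, hq]
  | mul_X p i hp => fin_cases i <;> simp [hp]

lemma eq_zero_of_dehomogenize_eq_zero {F : MvPolynomial (Fin 2) k} (hF : F.IsHomogeneous d)
    (h : dehomogenize F = 0) : F = 0 := by
  rw [← homogenize_eq_of_isHomogeneous hF h, homogenize_zero]

lemma derivative_dehomogenize (F : MvPolynomial (Fin 2) k) :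
    derivative (dehomogenize F) = dehomogenize (MvPolynomial.pderiv 0 F) := by
  induction F using MvPolynomial.induction_on with
  | C a => simp
  | add p q hp hq => simp [hp, hq]
  | mul_X p i hp =>
    fin_cases i
    · simp only [Fin.zero_eta, map_mul, MvPolynomial.pderiv_mul, derivative_mul, hp,
        dehomogenize_X_zero, derivative_X, MvPolynomial.pderiv_X_self, map_add, map_one]
    · simp [hp]

/-- The Jacobian determinant of two binary forms. -/
noncomputable def jacobian (F G : MvPolynomial (Fin 2) k) : MvPolynomial (Fin 2) k :=
  MvPolynomial.pderiv 0 F * MvPolynomial.pderiv 1 G -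
    MvPolynomial.pderiv 1 F * MvPolynomial.pderiv 0 G

lemma isHomogeneous_jacobian {F G : MvPolynomial (Fin 2) k} (hF : F.IsHomogeneous d)
    (hG : G.IsHomogeneous d) : (jacobian F G).IsHomogeneous ((d - 1) + (d - 1)) :=
  (hF.pderiv.mul hG.pderiv).sub (hF.pderiv.mul hG.pderiv)

/-- By Euler's identity, the Jacobian of two forms of degree `d` dehomogenizes to `-d` times the
Wronskian. -/
lemma dehomogenize_jacobian {F G : MvPolynomial (Fin 2) k} (hF : F.IsHomogeneous d)
    (hG : G.IsHomogeneous d) :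
    dehomogenize (jacobian F G) = -(C (d : k) * wronskian (dehomogenize F) (dehomogenize G)) := by
  have euler : ∀ {H : MvPolynomial (Fin 2) k}, H.IsHomogeneous d →
      X * dehomogenize (MvPolynomial.pderiv 0 H) + dehomogenize (MvPolynomial.pderiv 1 H) =
        C (d : k) * dehomogenize H := by
    intro H hH
    have := congrArg dehomogenize hH.sum_X_mul_pderiv
    simpa [Fin.sum_univ_two] using this
  simp only [jacobian, wronskian, derivative_dehomogenize, map_sub, map_mul]
  linear_combination dehomogenize (MvPolynomial.pderiv 0 F) * euler hG -
    dehomogenize (MvPolynomial.pderiv 0 G) * euler hF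

lemma pow_pred_dvd_pderiv {L H : MvPolynomial (Fin 2) k} {m : ℕ} (h : L ^ m ∣ H) (i : Fin 2) :
    L ^ (m - 1) ∣ MvPolynomial.pderiv i H := by
  obtain ⟨Q, rfl⟩ := h
  rw [MvPolynomial.pderiv_mul, MvPolynomial.pderiv_pow]
  refine dvd_add ⟨m * MvPolynomial.pderiv i L * Q, by ring⟩ ?_
  exact (pow_dvd_pow L (Nat.sub_le m 1)).mul_right _

/-- A point of multiplicity `m` in a fibre is a zero of order at least `m - 1` of the Jacobian. -/
lemma pow_pred_dvd_jacobian {L F G : MvPolynomial (Fin 2) k} {m : ℕ} {a b : k}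
    (hab : a ≠ 0 ∨ b ≠ 0) (h : L ^ m ∣ MvPolynomial.C a * F - MvPolynomial.C b * G) :
    L ^ (m - 1) ∣ jacobian F G := by
  have h0 := pow_pred_dvd_pderiv h 0
  have h1 := pow_pred_dvd_pderiv h 1
  rw [map_sub, MvPolynomial.pderiv_C_mul, MvPolynomial.pderiv_C_mul] at h0 h1
  rcases hab with ha | hb
  · have hu : IsUnit (MvPolynomial.C a : MvPolynomial (Fin 2) k) := ha.isUnit.map MvPolynomial.C
    rw [← hu.dvd_mul_left]
    convert dvd_sub (h0.mul_right (MvPolynomial.pderiv 1 G))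
      (h1.mul_right (MvPolynomial.pderiv 0 G)) using 1
    rw [jacobian]; ring
  · have hu : IsUnit (MvPolynomial.C b : MvPolynomial (Fin 2) k) := hb.isUnit.map MvPolynomial.C
    rw [← hu.dvd_mul_left]
    convert dvd_sub (h0.mul_right (MvPolynomial.pderiv 1 F))
      (h1.mul_right (MvPolynomial.pderiv 0 F)) using 1
    rw [jacobian]; ring

lemma isHomogeneous_linForm (v : Fin 2 → k) : (linForm v).IsHomogeneous 1 := by
  have h : ∀ (a : k) (i : Fin 2), (MvPolynomial.C a * MvPolynomial.X i).IsHomogeneous 1 :=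
    fun a i => by
      simpa using (MvPolynomial.isHomogeneous_C _ a).mul (MvPolynomial.isHomogeneous_X k i)
  exact (h _ _).sub (h _ _)

lemma det_rep_ne_zero {P Q : P1 k} (h : P ≠ Q) :
    P.rep 1 * Q.rep 0 - P.rep 0 * Q.rep 1 ≠ 0 := by
  intro h0
  have hli := LinearIndependent.pair_iff.mp (Projectivization.linearIndependent_pair_iff_ne.mpr h)
  refine P.rep_nonzero (funext fun i => ?_)
  have := (hli (Q.rep i) (-P.rep i) (funext fun j => ?_)).2
  · simpa using this
  · fin_cases i <;> fin_cases j <;> simp <;> first | ring1 | linear_combination h0 |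
      linear_combination -h0

lemma isRelPrime_linForm {P Q : P1 k} (h : P ≠ Q) :
    IsRelPrime (linForm P.rep) (linForm Q.rep) := by
  intro D hP hQ
  have hu : IsUnit (MvPolynomial.C (P.rep 1 * Q.rep 0 - P.rep 0 * Q.rep 1) :
      MvPolynomial (Fin 2) k) := (det_rep_ne_zero h).isUnit.map MvPolynomial.C
  have h0 : D ∣ MvPolynomial.X 0 := by
    rw [← hu.dvd_mul_left]
    convert dvd_sub (hP.mul_left (MvPolynomial.C (Q.rep 0)))
      (hQ.mul_left (MvPolynomial.C (P.rep 0))) using 1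
    simp only [linForm, map_sub, map_mul]; ring
  have h1 : D ∣ MvPolynomial.X 1 := by
    rw [← hu.dvd_mul_left]
    convert dvd_sub (hP.mul_left (MvPolynomial.C (Q.rep 1)))
      (hQ.mul_left (MvPolynomial.C (P.rep 1))) using 1
    simp only [linForm, map_sub, map_mul]; ring
  refine (MvPolynomial.X_prime (R := k)).irreducible.isRelPrime_iff_not_dvd.mpr ?_ h0 h1
  simp [MvPolynomial.X_dvd_X]

/-- A nonzero binary form divisible by a form of the same degree is a nonzero multiple of it. -/
lemma exists_C_mul_eq_of_dvd {m : ℕ} {H J : MvPolynomial (Fin 2) k} (hH : H.IsHomogeneous m)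
    (hJ : J.IsHomogeneous m) (hJ0 : J ≠ 0) (h : H ∣ J) :
    ∃ c : k, c ≠ 0 ∧ J = MvPolynomial.C c * H := by
  obtain ⟨Q, rfl⟩ := h
  have hH0 := left_ne_zero_of_mul hJ0
  have hQ0 := right_ne_zero_of_mul hJ0
  have hdeg := MvPolynomial.totalDegree_mul_of_isDomain hH0 hQ0
  rw [hJ.totalDegree hJ0, hH.totalDegree hH0] at hdeg
  have hQ := MvPolynomial.totalDegree_eq_zero_iff_eq_C.mp (by omega : Q.totalDegree = 0)
  refine ⟨Q.coeff 0, fun hc => hQ0 ?_, ?_⟩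
  · rw [hQ, hc, map_zero]
  · rw [← hQ, mul_comm]

/-! ### Self-maps and their pencils -/

/-- Pairs with proportional Plücker coordinates span the same pencil. -/
lemma exists_det_ne_zero_of_plucker_eq {u u' : Fin 2 → k[X]} {c : k} (hc : c ≠ 0)
    (hw : wronskian (u' 0) (u' 1) ≠ 0)
    (h : ∀ i j, plucker (u 0) (u 1) i j = c * plucker (u' 0) (u' 1) i j) :
    ∃ M : Matrix (Fin 2) (Fin 2) k, M.det ≠ 0 ∧ ∀ s, u' s = ∑ t, C (M s t) * u t := by
  obtain ⟨I, J, hq⟩ : ∃ I J, plucker (u' 0) (u' 1) I J ≠ 0 := by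
    by_contra! h0
    have hrow : ∀ I, pluckerRow (u' 0) (u' 1) I = 0 := fun I =>
      Polynomial.ext fun m => by rw [coeff_pluckerRow, h0, coeff_zero]
    have hf : u' 0 = 0 := by
      ext I
      have h1 : C ((u' 0).coeff I) * wronskian (u' 0) (u' 1) = 0 := by
        have h2 := congrArg (wronskian (u' 0)) (hrow I)
        simp only [pluckerRow, wronskian, derivative_sub, derivative_mul, derivative_C,
          derivative_zero] at h2 ⊢
        linear_combination h2
      simpa [hw] using h1
    exact hw (by rw [hf, wronskian_zero_left])
  have hrow : ∀ L, pluckerRow (u 0) (u 1) L = C c * pluckerRow (u' 0) (u' 1) L := fun L =>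
    Polynomial.ext fun m => by rw [coeff_pluckerRow, coeff_C_mul, coeff_pluckerRow, h]
  set q := plucker (u' 0) (u' 1) I J with hqdef
  -- Cramer's rule expresses `u'` through the rows of index `I` and `J` of `u'`, hence of `u`.
  let r : k := (c * q)⁻¹
  let N : Fin 2 → Fin 2 → k := fun s t =>
    ![-(r * ((u' s).coeff J * (u 1).coeff I - (u' s).coeff I * (u 1).coeff J)),
      r * ((u' s).coeff J * (u 0).coeff I - (u' s).coeff I * (u 0).coeff J)] t
  have hN : ∀ s, u' s = C (N s 0) * u 0 + C (N s 1) * u 1 := by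
    intro s
    have hr : C r * C c * C q = (1 : k[X]) := by
      rw [← C_mul, ← C_mul, mul_assoc, inv_mul_cancel₀ (mul_ne_zero hc hq), C_1]
    have hcr : C q * u' s = C ((u' s).coeff J) * pluckerRow (u' 0) (u' 1) I -
        C ((u' s).coeff I) * pluckerRow (u' 0) (u' 1) J := by
      rw [hqdef]
      fin_cases s <;> simp only [plucker, pluckerRow, map_sub, map_mul] <;> simp <;> ring
    have h1 := hrow I
    have h2 := hrow J
    simp only [N, Matrix.cons_val_zero, Matrix.cons_val_one, map_neg, map_mul, map_sub]
    unfold pluckerRow at h1 h2 hcr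
    linear_combination (-(u' s)) * hr + C r * C c * hcr - C r * C ((u' s).coeff J) * h1 +
      C r * C ((u' s).coeff I) * h2
  refine ⟨Matrix.of N, fun hdet => hq ?_, fun s => by rw [Fin.sum_univ_two]; exact hN s⟩
  rw [Matrix.det_fin_two] at hdet
  simp only [Matrix.of_apply] at hdet
  rw [hqdef, plucker, hN 0, hN 1]
  simp only [coeff_add, coeff_C_mul]
  linear_combination hdet * ((u 0).coeff I * (u 1).coeff J - (u 0).coeff J * (u 1).coeff I)

namespace SelfMap

/-- The two polynomials obtained from a self-map by restricting to the affine line `[t : 1]`. -/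
noncomputable def affine (φ : SelfMap k d) (s : Fin 2) : k[X] := dehomogenize (φ.form s)

lemma natDegree_affine_le (φ : SelfMap k d) (s : Fin 2) : (φ.affine s).natDegree ≤ d :=
  natDegree_dehomogenize_le (φ.isHomogeneous s)

lemma form_eq_sum {φ ψ : SelfMap k d} {M : Matrix (Fin 2) (Fin 2) k}
    (h : ∀ s, ψ.affine s = ∑ t, C (M s t) * φ.affine t) (s : Fin 2) :
    ψ.form s = ∑ t, MvPolynomial.C (M s t) * φ.form t := by
  rw [← sub_eq_zero]
  refine eq_zero_of_dehomogenize_eq_zero (d := d) ((ψ.isHomogeneous s).sub ?_) ?_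
  · refine MvPolynomial.IsHomogeneous.sum _ _ _ fun t _ => ?_
    simpa using (MvPolynomial.isHomogeneous_C _ (M s t)).mul (φ.isHomogeneous t)
  · have := h s
    simp only [affine] at this
    rw [map_sub, this, map_sum]
    simp

/-- Self-maps spanning the same pencil differ by an automorphism of the image. -/
lemma imageAut_of_affine_eq {φ ψ : SelfMap k d} {M : Matrix (Fin 2) (Fin 2) k} (hM : M.det ≠ 0)
    (h : ∀ s, ψ.affine s = ∑ t, C (M s t) * φ.affine t) :
    (imageAutSetoid k d).r φ ψ := by
  refine ⟨Matrix.GeneralLinearGroup.toLin (Matrix.GeneralLinearGroup.mkOfDetNeZero M hM),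
    fun P => ?_⟩
  unfold toFun
  rw [Projectivization.smul_mk]
  congr 1
  funext s
  rw [form_eq_sum h s]
  simp [Matrix.mulVec, dotProduct, Units.smul_def, Matrix.GeneralLinearGroup.mkOfDetNeZero,
    Matrix.GeneralLinearGroup.mk']
  rfl

end SelfMap

/-- Over an algebraically closed field, a binary form of positive degree has a nontrivial zero. -/
lemma exists_eval_eq_zero [IsAlgClosed k] {F : MvPolynomial (Fin 2) k} (hF : F.IsHomogeneous d)
    (hd : d ≠ 0) : ∃ v : Fin 2 → k, v ≠ 0 ∧ MvPolynomial.eval v F = 0 := by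
  by_cases hf : (dehomogenize F).degree = 0
  · refine ⟨![1, 0], fun h => one_ne_zero (congrFun h 0), ?_⟩
    rw [← homogenize_eq_of_isHomogeneous hF (eq_C_of_degree_eq_zero hf), homogenize_C]
    simp [hd]
  · obtain ⟨r, hr⟩ := IsAlgClosed.exists_root _ hf
    refine ⟨![r, 1], fun h => one_ne_zero (congrFun h 1), ?_⟩
    rw [← eval_dehomogenize]
    exact hr

namespace SelfMap

lemma wronskian_affine_ne_zero [IsAlgClosed k] (hd0 : d ≠ 0)
    (hd : ∀ n : ℕ, 1 ≤ n → n ≤ d → (n : k) ≠ 0) (φ : SelfMap k d) :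
    wronskian (φ.affine 0) (φ.affine 1) ≠ 0 := by
  refine wronskian_ne_zero hd (φ.natDegree_affine_le 0) (φ.natDegree_affine_le 1)
    fun a b hab => ?_
  have hform : MvPolynomial.C a * φ.form 0 + MvPolynomial.C b * φ.form 1 = 0 := by
    refine eq_zero_of_dehomogenize_eq_zero (d := d) (.add ?_ ?_) (by simpa [affine] using hab)
    · simpa using (MvPolynomial.isHomogeneous_C _ a).mul (φ.isHomogeneous 0)
    · simpa using (MvPolynomial.isHomogeneous_C _ b).mul (φ.isHomogeneous 1)
  have heval : ∀ v, a * MvPolynomial.eval v (φ.form 0) + b * MvPolynomial.eval v (φ.form 1) = 0 :=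
    fun v => by simpa using congrArg (MvPolynomial.eval v) hform
  -- In a nontrivial relation, a zero of the one form is a zero of the other.
  constructor
  · by_contra ha
    obtain ⟨v, hv, hv0⟩ := exists_eval_eq_zero (φ.isHomogeneous 1) hd0
    have := heval v
    refine φ.no_common_zero v hv (funext fun i => ?_)
    fin_cases i <;> simp_all
  · by_contra hb
    obtain ⟨v, hv, hv0⟩ := exists_eval_eq_zero (φ.isHomogeneous 0) hd0
    have := heval v
    refine φ.no_common_zero v hv (funext fun i => ?_)
    fin_cases i <;> simp_all

lemma pow_pred_dvd_jacobian_form {φ : SelfMap k d} {P : P1 k} {m : ℕ}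
    (h : φ.ramificationIndex P = m) :
    linForm P.rep ^ (m - 1) ∣ jacobian (φ.form 0) (φ.form 1) := by
  refine pow_pred_dvd_jacobian (a := (φ.toFun P).rep 1) (b := (φ.toFun P).rep 0) ?_
    (pow_dvd_of_le_emultiplicity h.ge)
  by_contra! h0
  refine (φ.toFun P).rep_nonzero (funext fun i => ?_)
  fin_cases i
  exacts [h0.2, h0.1]

end SelfMap

end SelfMapsP1

/-! ### Finiteness of self-maps with given ramification -/

open Polynomial SelfMapsP1 in
/-- The hypothesis `hsum` says that the ramification divisor has the full degree `2d - 2` of the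
Jacobian, written with truncated subtraction. -/
theorem SelfMapsP1.finite_of_ramificationIndex_eq {k : Type*} [Field k] [IsAlgClosed k] {d n : ℕ}
    (hd : ∀ m : ℕ, 1 ≤ m → m ≤ d → (m : k) ≠ 0) (hd0 : d ≠ 0) {P : Fin n → P1 k}
    (hP : Function.Injective P) {e : Fin n → ℕ} (hsum : ∑ i, (e i - 1) = (d - 1) + (d - 1)) :
    {c : Quotient (SelfMap.imageAutSetoid k d) | ∃ φ : SelfMap k d,
      Quotient.mk (SelfMap.imageAutSetoid k d) φ = c ∧
        ∀ i, φ.ramificationIndex (P i) = (e i : ℕ∞)}.Finite := by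
  set H : MvPolynomial (Fin 2) k := ∏ i, linForm (P i).rep ^ (e i - 1) with hH
  have hHhom : H.IsHomogeneous ((d - 1) + (d - 1)) := by
    rw [← hsum]
    refine MvPolynomial.IsHomogeneous.prod _ _ _ fun i _ => ?_
    simpa using (isHomogeneous_linForm (P i).rep).pow (e i - 1)
  have hdk : (d : k) ≠ 0 := hd d (Nat.one_le_iff_ne_zero.mpr hd0) le_rfl
  -- The ramification conditions determine the Wronskian up to a scalar.
  have key : ∀ φ : SelfMap k d, (∀ i, φ.ramificationIndex (P i) = (e i : ℕ∞)) →
      ∃ a : k, a ≠ 0 ∧ C a * wronskian (φ.affine 0) (φ.affine 1) = dehomogenize H := by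
    intro φ hφ
    have hdvd : H ∣ jacobian (φ.form 0) (φ.form 1) :=
      Fintype.prod_dvd_of_isRelPrime (fun i j hij => (isRelPrime_linForm (hP.ne hij)).pow)
        fun i => SelfMap.pow_pred_dvd_jacobian_form (hφ i)
    have hJ := dehomogenize_jacobian (φ.isHomogeneous 0) (φ.isHomogeneous 1)
    have hJ0 : jacobian (φ.form 0) (φ.form 1) ≠ 0 := by
      intro h0
      rw [h0, map_zero, zero_eq_neg, mul_eq_zero, C_eq_zero] at hJ
      exact hJ.elim hdk (φ.wronskian_affine_ne_zero hd0 hd)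
    obtain ⟨c, hc, hcH⟩ := exists_C_mul_eq_of_dvd hHhom
      (isHomogeneous_jacobian (φ.isHomogeneous 0) (φ.isHomogeneous 1)) hJ0 hdvd
    refine ⟨-(c⁻¹ * d), neg_ne_zero.mpr (mul_ne_zero (inv_ne_zero hc) hdk), ?_⟩
    rw [hcH, map_mul, dehomogenize_C] at hJ
    have hcc : C c⁻¹ * C c = (1 : k[X]) := by rw [← C_mul, inv_mul_cancel₀ hc, C_1]
    simp only [SelfMap.affine, map_neg, map_mul]
    linear_combination dehomogenize H * hcc - C c⁻¹ * hJ
  -- It then suffices that each of the finitely many Plücker vectors, up to a scalar, comes from one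
  -- class at most.
  refine ((finite_plucker hd (dehomogenize H)).biUnion (t := fun v =>
    {c | ∃ φ : SelfMap k d, Quotient.mk (SelfMap.imageAutSetoid k d) φ = c ∧
      ∃ a : k, a ≠ 0 ∧ ∀ i j, v i j = a * plucker (φ.affine 0) (φ.affine 1) i j})
    fun v _ => Set.Subsingleton.finite ?_).subset ?_
  · rintro - ⟨φ, rfl, a, ha, hφ⟩ - ⟨ψ, rfl, b, hb, hψ⟩
    obtain ⟨M, hM, hMs⟩ := exists_det_ne_zero_of_plucker_eq (u := φ.affine) (u' := ψ.affine)
      (mul_ne_zero (inv_ne_zero ha) hb) (ψ.wronskian_affine_ne_zero hd0 hd) fun i j => by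
        rw [mul_assoc, ← hψ, hφ, inv_mul_cancel_left₀ ha]
    exact Quotient.sound (SelfMap.imageAut_of_affine_eq hM hMs)
  · rintro - ⟨φ, rfl, hφ⟩
    obtain ⟨a, ha, hw⟩ := key φ hφ
    refine Set.mem_biUnion ⟨![C a * φ.affine 0, φ.affine 1], fun s => ?_, ?_, rfl⟩
      ⟨φ, rfl, a, ha, fun i j => ?_⟩
    · fin_cases s
      · exact (natDegree_C_mul_le _ _).trans (φ.natDegree_affine_le 0)
      · exact φ.natDegree_affine_le 1
    · rw [← hw]
      simp only [Matrix.cons_val_zero, Matrix.cons_val_one, wronskian, derivative_mul, derivative_C]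
      ring
    · simp only [Matrix.cons_val_zero, Matrix.cons_val_one, plucker, coeff_C_mul]
      ring

theorem mainTheorem11 {k : Type*} [Field k] [IsAlgClosed k] (p : ℕ) [CharP k p]
    (d : ℕ) (hp : p = 0 ∨ d < p)
    (n : ℕ) (P : Fin n → SelfMapsP1.P1 k) (hP : Function.Injective P)
    (e : Fin n → ℕ) (he : ∀ i, 2 ≤ e i)
    (hsum : ∑ i, ((e i : ℤ) - 1) = 2 * (d : ℤ) - 2) :
    Set.Finite {c : Quotient (SelfMapsP1.SelfMap.imageAutSetoid k d) |
      ∃ φ : SelfMapsP1.SelfMap k d,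
        Quotient.mk (SelfMapsP1.SelfMap.imageAutSetoid k d) φ = c ∧
        ∀ i, φ.ramificationIndex (P i) = (e i : ℕ∞)} := by
  have hcast : ((∑ i, (e i - 1) : ℕ) : ℤ) = 2 * (d : ℤ) - 2 := by
    rw [← hsum, Nat.cast_sum]
    exact Finset.sum_congr rfl fun i _ => by have := he i; omega
  refine SelfMapsP1.finite_of_ramificationIndex_eq (fun m h1 h2 hm => ?_) (by omega) hP (by omega)
  rw [CharP.cast_eq_zero_iff k p] at hm
  rcases hp with rfl | hp
  · have := Nat.eq_zero_of_zero_dvd hm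
    omega
  · have := Nat.le_of_dvd h1 hm
    omega
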